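/- Let $\Gamma\subset\mathbb{R}^k$ be a non-empty, compact, smooth, boundaryless embedded submanifold of dimension $d$ (of arbitrary codimension $k-d$). Let $\rho(x)=\operatorname{dist}(x,\Gamma)$, let $U_\delta(\Gamma)=\{x\in\mathbb{R}^k:\rho(x)<\delta\}$, and for $q\in\Gamma$ let $P_\Gamma(q)$ be the orthogonal projection of $\mathbb{R}^k$ onto the tangent space $T_q\Gamma$. Then there are $\delta_0>0$ and a constant $C$, depending only on $\Gamma$, such that for every $0<\delta\le\delta_0$ the following hold. Every $x\in U_\delta(\Gamma)$ has a unique closest point $p(x)$ on $\Gamma$; the closest point projection $p:U_\delta(\Gamma)\to\Gamma$ is differentiable; and there is a measurable matrix-valued function $\mathcal{H}:U_\delta(\Gamma)\to\mathbb{R}^{k\times k}$ such that, for all $x\in U_\delta(\Gamma)$, $$Dp(x)=P_\Gamma(p(x))\,\bigl(I-\rho(x)\,\mathcal{H}(x)\bigr),\qquad \|\mathcal{H}(x)\|\le C,\qquad \mathcal{H}(x)\,P_\Gamma(p(x))=\mathcal{H}(x).$$ -/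

import Mathlib

open scoped Manifold ContDiff

noncomputable section

/-- The tangent space of the embedded manifold `Γ = range ι` at the point `ι m`, as a linear
subspace of the ambient space `ℝᵏ`: the image of the differential of `ι` at `m`. -/
def tangentPlane {d k : ℕ} {M : Type*} [TopologicalSpace M]
    [ChartedSpace (EuclideanSpace ℝ (Fin d)) M]
    (ι : M → EuclideanSpace ℝ (Fin k)) (m : M) : Submodule ℝ (EuclideanSpace ℝ (Fin k)) :=
  LinearMap.range
    (mfderiv (𝓡 d) 𝓘(ℝ, EuclideanSpace ℝ (Fin k)) ι m :
      EuclideanSpace ℝ (Fin d) →L[ℝ] EuclideanSpace ℝ (Fin k)).toLinearMap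

/-- The orthogonal projection `P_Γ` of `ℝᵏ` onto the tangent space of `Γ = range ι` at `ι m`. -/
def tangentProjection {d k : ℕ} {M : Type*} [TopologicalSpace M]
    [ChartedSpace (EuclideanSpace ℝ (Fin d)) M]
    (ι : M → EuclideanSpace ℝ (Fin k)) (m : M) :
    EuclideanSpace ℝ (Fin k) →L[ℝ] EuclideanSpace ℝ (Fin k) :=
  (tangentPlane (d := d) ι m).starProjection

/-- The tubular neighbourhood `U_δ(Γ) = {x | ρ(x) < δ}`, where `ρ(x) = dist(x, Γ)`. -/
def tubularNhd {k : ℕ} (Γ : Set (EuclideanSpace ℝ (Fin k))) (δ : ℝ) :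
    Set (EuclideanSpace ℝ (Fin k)) :=
  {x | Metric.infDist x Γ < δ}

/-- `q` is a closest point to `x` on `Γ`. -/
def IsClosestPoint {k : ℕ} (Γ : Set (EuclideanSpace ℝ (Fin k)))
    (x q : EuclideanSpace ℝ (Fin k)) : Prop :=
  q ∈ Γ ∧ dist x q = Metric.infDist x Γ

/-- The closest point projection `p` (meaningful at the points which have a unique closest point
on `Γ`, arbitrary elsewhere). -/
def closestPointProjection {k : ℕ} (Γ : Set (EuclideanSpace ℝ (Fin k)))
    (x : EuclideanSpace ℝ (Fin k)) : EuclideanSpace ℝ (Fin k) :=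
  Classical.epsilon (IsClosestPoint Γ x)

end

/-! Write P for the tangent projection at p(x). The matrix is forced up to the choice H = (P -
Dp(x)) / ρ(x), so everything rests on three facts. Differentiating p ∘ p = p gives P Dp(x) = Dp(x),
because Dp = P on Γ; this yields P(I - ρH) = Dp(x). Moving x along a normal at p(x) does not move
p(x), so Dp(x) P = Dp(x) and HP = H. Finally P = Dp(p(x)), and Dp is Lipschitz near Γ, so |P -
Dp(x)| ≤ C ρ(x). Uniqueness and smoothness of p come from the implicit function theorem for the
first order condition ⟨f(u) - x, Df(u)·⟩ = 0 in a chart (`exists_foot`,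
`eventually_closestPoint_eq`). Compactness of Γ makes δ₀ and C uniform
(`exists_uniform_tubularNhd`). -/

open Set Filter Topology

/-! ### The first order condition and its smooth solution -/

section Foot

variable {V W : Type*} [NormedAddCommGroup V] [NormedSpace ℝ V]
  [NormedAddCommGroup W] [InnerProductSpace ℝ W]

/-- The half differential at `u` of the squared distance from `x` to the parametrized point `f u`,
as a function of the pair `(x, u)`. -/
noncomputable def footDefect (f : V → W) (v : W × V) : V →L[ℝ] ℝ :=
  innerSL ℝ (f v.2 - v.1) ∘L fderiv ℝ f v.2

theorem footDefect_apply (f : V → W) (x : W) (u h : V) :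
    footDefect f (x, u) h = inner ℝ (f u - x) (fderiv ℝ f u h) := rfl

theorem footDefect_self (f : V → W) (u : V) : footDefect f (f u, u) = 0 := by
  ext h; simp [footDefect_apply]

theorem contDiffAt_footDefect {f : V → W} {x : W} {u : V} (hf : ContDiffAt ℝ ∞ f u) :
    ContDiffAt ℝ ∞ (footDefect f) (x, u) := by
  have h1 : ContDiffAt ℝ ∞ (fun v : W × V ↦ f v.2) (x, u) := hf.comp (x, u) contDiffAt_snd
  have h2 : ContDiffAt ℝ ∞ (fun v : W × V ↦ fderiv ℝ f v.2) (x, u) :=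
    (hf.fderiv_right (m := ∞) (by simp)).comp (x, u) contDiffAt_snd
  have h3 : ContDiffAt ℝ ∞ (fun v : W × V ↦ innerSL ℝ (f v.2 - v.1)) (x, u) :=
    (innerSL ℝ (E := W)).contDiff.contDiffAt.comp (x, u) (h1.sub contDiffAt_fst)
  exact h3.clm_comp h2

theorem footDefect_eq_zero_of_isLocalMin {f : V → W} {x : W} {u : V}
    (hf : DifferentiableAt ℝ f u) (hmin : IsLocalMin (fun v ↦ dist x (f v)) u) :
    footDefect f (x, u) = 0 := by
  have hmin' : IsLocalMin (fun v ↦ ‖f v - x‖ ^ 2) u := by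
    filter_upwards [hmin] with v hv
    rw [dist_comm, dist_comm x, dist_eq_norm, dist_eq_norm] at hv
    gcongr
  have h := hmin'.hasFDerivAt_eq_zero ((hf.hasFDerivAt.sub_const x).norm_sq)
  ext h'
  have := congrArg (fun T : V →L[ℝ] ℝ ↦ T h') h
  simpa [footDefect_apply, inner_sub_left] using this

/-- The second derivative of `f` enters only paired with `f u - x`, which vanishes at `x = f u`; the
first fundamental form is what remains. -/
theorem fderiv_footDefect_comp_inr {f : V → W} {u : V} (hf : ContDiffAt ℝ ∞ f u) (h h' : V) :
    (fderiv ℝ (footDefect f) (f u, u) ∘L .inr ℝ W V) h h' =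
      inner ℝ (fderiv ℝ f u h) (fderiv ℝ f u h') := by
  have hd : HasFDerivAt f (fderiv ℝ f u) u := (hf.differentiableAt (by simp)).hasFDerivAt
  have hD : HasFDerivAt (fderiv ℝ f) (fderiv ℝ (fderiv ℝ f) u) u :=
    ((hf.fderiv_right (m := ∞) (by simp)).differentiableAt (by simp)).hasFDerivAt
  have h1 : HasFDerivAt (fun v ↦ footDefect f (f u, v))
      (fderiv ℝ (footDefect f) (f u, u) ∘L .inr ℝ W V) u :=
    HasFDerivAt.comp u (g := footDefect f) (f := fun v ↦ (f u, v))
      ((contDiffAt_footDefect hf).differentiableAt (by simp)).hasFDerivAt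
      (hasFDerivAt_prodMk_right (f u) u)
  have h2 : HasFDerivAt (fun v ↦ footDefect f (f u, v) h')
      ((ContinuousLinearMap.apply ℝ ℝ h') ∘L
        (fderiv ℝ (footDefect f) (f u, u) ∘L .inr ℝ W V)) u :=
    (ContinuousLinearMap.apply ℝ ℝ h').hasFDerivAt.comp u h1
  have h3 : HasFDerivAt (fun v ↦ inner ℝ (f v - f u) (fderiv ℝ f v h')) _ u :=
    (hd.sub_const (f u)).inner ℝ
      ((ContinuousLinearMap.apply ℝ W h').hasFDerivAt.comp u hD)
  have h4 := congrArg (fun T : V →L[ℝ] ℝ ↦ T h) (h2.unique h3)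
  simpa [fderivInnerCLM_apply] using h4

/-- Near an immersed point, the solutions of the first order condition for the closest point are
parametrized smoothly by the ambient point. -/
theorem exists_foot [FiniteDimensional ℝ V] [CompleteSpace W] {f : V → W} {u₀ : V}
    (hf : ContDiffAt ℝ ∞ f u₀) (hinj : Function.Injective (fderiv ℝ f u₀)) :
    ∃ g : W → V, ContDiffAt ℝ ∞ g (f u₀) ∧ g (f u₀) = u₀ ∧
      ∀ᶠ v in 𝓝 (f u₀, u₀), footDefect f v = 0 ↔ g v.1 = v.2 := by
  have : CompleteSpace V := FiniteDimensional.complete ℝ V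
  have cdf := contDiffAt_footDefect (x := f u₀) hf
  -- The Gram form is positive definite, hence injective into the dual, which has the same
  -- dimension.
  have hinv : (fderiv ℝ (footDefect f) (f u₀, u₀) ∘L .inr ℝ W V).IsInvertible := by
    set T := fderiv ℝ (footDefect f) (f u₀, u₀) ∘L .inr ℝ W V with hT
    have hTinj : Function.Injective T := by
      rw [injective_iff_map_eq_zero]
      intro h hh
      have := fderiv_footDefect_comp_inr hf h h
      rw [← hT, hh] at this
      have h0 : fderiv ℝ f u₀ h = 0 := by simpa using this.symm
      exact hinj (by simpa using h0)
    have hdim : Module.finrank ℝ V = Module.finrank ℝ (V →L[ℝ] ℝ) := by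
      rw [← Subspace.dual_finrank_eq (K := ℝ) (V := V)]
      exact (LinearMap.toContinuousLinearMap (𝕜 := ℝ) (E := V) (F' := ℝ)).finrank_eq
    refine ⟨(T.toLinearMap.linearEquivOfInjective hTinj hdim).toContinuousLinearEquiv, ?_⟩
    ext h : 1
    rfl
  refine ⟨cdf.implicitFunction (by simp) hinv, cdf.contDiffAt_implicitFunction (by simp) hinv,
    cdf.implicitFunction_apply_self (by simp) hinv, ?_⟩
  filter_upwards [cdf.eventually_apply_eq_iff_implicitFunction (by simp) hinv] with v hv
  rw [← hv, footDefect_self]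

end Foot

/-! ### The embedding read in charts -/

section Chart

variable {d k : ℕ} {M : Type*} [TopologicalSpace M] [ChartedSpace (EuclideanSpace ℝ (Fin d)) M]
  {ι : M → EuclideanSpace ℝ (Fin k)}

theorem contDiffAt_comp_symm_of_mem_maximalAtlas [IsManifold (𝓡 d) ∞ M]
    {φ : OpenPartialHomeomorph M (EuclideanSpace ℝ (Fin d))}
    (hφ : φ ∈ IsManifold.maximalAtlas (𝓡 d) ∞ M)
    (hι : ContMDiff (𝓡 d) 𝓘(ℝ, EuclideanSpace ℝ (Fin k)) ∞ ι)
    {u : EuclideanSpace ℝ (Fin d)} (hu : u ∈ φ.target) :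
    ContDiffAt ℝ ∞ (ι ∘ φ.symm) u :=
  (hι.contMDiffAt.comp u (contMDiffAt_symm_of_mem_maximalAtlas hφ hu)).contDiffAt

theorem range_fderiv_comp_symm_le_tangentPlane [IsManifold (𝓡 d) ∞ M]
    {φ : OpenPartialHomeomorph M (EuclideanSpace ℝ (Fin d))}
    (hφ : φ ∈ IsManifold.maximalAtlas (𝓡 d) ∞ M)
    (hι : ContMDiff (𝓡 d) 𝓘(ℝ, EuclideanSpace ℝ (Fin k)) ∞ ι)
    {m : M} (hm : m ∈ φ.source) (v : EuclideanSpace ℝ (Fin d)) :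
    fderiv ℝ (ι ∘ φ.symm) (φ m) v ∈ tangentPlane (d := d) ι m := by
  have h1 : MDifferentiableAt (𝓡 d) 𝓘(ℝ, EuclideanSpace ℝ (Fin k)) ι (φ.symm (φ m)) :=
    hι.contMDiffAt.mdifferentiableAt (by simp)
  have h2 : MDifferentiableAt 𝓘(ℝ, EuclideanSpace ℝ (Fin d)) (𝓡 d) φ.symm (φ m) :=
    (contMDiffAt_symm_of_mem_maximalAtlas hφ (φ.map_source hm)).mdifferentiableAt (by simp)
  have h3 := mfderiv_comp (φ m) h1 h2
  rw [mfderiv_eq_fderiv, φ.left_inv hm] at h3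
  rw [h3]
  exact ⟨_, rfl⟩

/-- In immersion charts the map is `u ↦ (u, 0)` up to a linear isomorphism, so the chain rule leaves
no kernel. -/
theorem Manifold.IsImmersionAt.injective_fderiv_comp_symm [IsManifold (𝓡 d) ∞ M] {m : M}
    (h : IsImmersionAt (𝓡 d) 𝓘(ℝ, EuclideanSpace ℝ (Fin k)) ∞ ι m)
    (hι : ContMDiff (𝓡 d) 𝓘(ℝ, EuclideanSpace ℝ (Fin k)) ∞ ι) :
    Function.Injective (fderiv ℝ (ι ∘ h.domChart.symm) (h.domChart m)) := by
  set φ := h.domChart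
  set ψ := h.codChart
  have hm : m ∈ φ.source := h.mem_domChart_source
  have hu : φ m ∈ φ.target := φ.map_source hm
  have hf : DifferentiableAt ℝ (ι ∘ φ.symm) (φ m) :=
    (contDiffAt_comp_symm_of_mem_maximalAtlas h.domChart_mem_maximalAtlas hι hu).differentiableAt
      (by simp)
  have hψ : DifferentiableAt ℝ ψ ((ι ∘ φ.symm) (φ m)) := by
    rw [Function.comp_apply, φ.left_inv hm]
    exact (contMDiffAt_of_mem_maximalAtlas h.codChart_mem_maximalAtlas
      h.mem_codChart_source).contDiffAt.differentiableAt (by simp)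
  have heq : ψ ∘ (ι ∘ φ.symm) =ᶠ[𝓝 (φ m)] fun u ↦ h.equiv (u, 0) := by
    filter_upwards [φ.open_target.mem_nhds hu] with u hu'
    have hu'' : u ∈ (φ.extend (𝓡 d)).target := by simpa using hu'
    simpa [φ, ψ] using h.writtenInCharts hu''
  have h1 : HasFDerivAt (fun u : EuclideanSpace ℝ (Fin d) ↦ h.equiv (u, 0))
      (h.equiv.toContinuousLinearMap ∘L .inl ℝ _ h.complement) (φ m) :=
    (h.equiv.toContinuousLinearMap ∘L .inl ℝ _ h.complement).hasFDerivAt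
  have h2 := (hψ.hasFDerivAt.comp (φ m) hf.hasFDerivAt).unique (h1.congr_of_eventuallyEq heq)
  rw [injective_iff_map_eq_zero]
  intro v hv
  have h3 := congrArg (fun T : EuclideanSpace ℝ (Fin d) →L[ℝ] EuclideanSpace ℝ (Fin k) ↦ T v) h2
  simp only [ContinuousLinearMap.comp_apply, hv, map_zero] at h3
  have h4 := h.equiv.injective (h3.symm.trans (map_zero h.equiv).symm)
  exact congrArg Prod.fst h4

end Chart

/-! ### Closest points and the identities p ∘ p = p and p ∘ ι = ι -/

section ClosestPoint

variable {k : ℕ} {Γ : Set (EuclideanSpace ℝ (Fin k))} {x q : EuclideanSpace ℝ (Fin k)}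

theorem exists_isClosestPoint (hΓ : IsCompact Γ) (hne : Γ.Nonempty)
    (x : EuclideanSpace ℝ (Fin k)) : ∃ q, IsClosestPoint Γ x q :=
  let ⟨q, hq, h⟩ := hΓ.exists_infDist_eq_dist hne x
  ⟨q, hq, h.symm⟩

theorem isClosestPoint_closestPointProjection (hΓ : IsCompact Γ) (hne : Γ.Nonempty)
    (x : EuclideanSpace ℝ (Fin k)) : IsClosestPoint Γ x (closestPointProjection Γ x) :=
  Classical.epsilon_spec (exists_isClosestPoint hΓ hne x)

theorem closestPointProjection_of_mem (hΓ : IsCompact Γ) (hq : q ∈ Γ) :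
    closestPointProjection Γ q = q := by
  have h := (isClosestPoint_closestPointProjection hΓ ⟨q, hq⟩ q).2
  rw [Metric.infDist_zero_of_mem hq, dist_eq_zero] at h
  exact h.symm

theorem IsClosestPoint.dist_le {y : EuclideanSpace ℝ (Fin k)} (h : IsClosestPoint Γ x q)
    (hy : y ∈ Γ) : dist x q ≤ dist x y :=
  h.2.trans_le (Metric.infDist_le_dist_of_mem hy)

theorem IsClosestPoint.dist_le_two_mul {y : EuclideanSpace ℝ (Fin k)} (h : IsClosestPoint Γ x q)
    (hy : y ∈ Γ) : dist q y ≤ 2 * dist x y := by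
  have := dist_triangle_left q y x
  have := h.dist_le hy
  linarith

theorem fderiv_closestPointProjection_comp_self {x : EuclideanSpace ℝ (Fin k)}
    (hΓ : IsCompact Γ) (hne : Γ.Nonempty)
    (hx : DifferentiableAt ℝ (closestPointProjection Γ) x)
    (hp : DifferentiableAt ℝ (closestPointProjection Γ) (closestPointProjection Γ x)) :
    fderiv ℝ (closestPointProjection Γ) (closestPointProjection Γ x) ∘L
      fderiv ℝ (closestPointProjection Γ) x = fderiv ℝ (closestPointProjection Γ) x := by
  have h := hp.hasFDerivAt.comp x hx.hasFDerivAt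
  have he : closestPointProjection Γ ∘ closestPointProjection Γ = closestPointProjection Γ :=
    funext fun y ↦ closestPointProjection_of_mem hΓ
      (isClosestPoint_closestPointProjection hΓ hne y).1
  rw [he] at h
  exact h.unique hx.hasFDerivAt

theorem fderiv_closestPointProjection_of_mem_tangentPlane {d : ℕ} {M : Type*} [TopologicalSpace M]
    [CompactSpace M] [ChartedSpace (EuclideanSpace ℝ (Fin d)) M] [IsManifold (𝓡 d) ∞ M]
    {ι : M → EuclideanSpace ℝ (Fin k)}
    (hι : ContMDiff (𝓡 d) 𝓘(ℝ, EuclideanSpace ℝ (Fin k)) ∞ ι) {m : M}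
    (hp : DifferentiableAt ℝ (closestPointProjection (range ι)) (ι m))
    {v : EuclideanSpace ℝ (Fin k)} (hv : v ∈ tangentPlane (d := d) ι m) :
    fderiv ℝ (closestPointProjection (range ι)) (ι m) v = v := by
  obtain ⟨w, rfl⟩ := hv
  have he : closestPointProjection (range ι) ∘ ι = ι :=
    funext fun y ↦ closestPointProjection_of_mem (isCompact_range hι.continuous) (mem_range_self y)
  have h1 : MDifferentiableAt (𝓡 d) 𝓘(ℝ, EuclideanSpace ℝ (Fin k)) ι m :=
    hι.contMDiffAt.mdifferentiableAt (by simp)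
  have h2 := mfderiv_comp m hp.mdifferentiableAt h1
  rw [he, mfderiv_eq_fderiv] at h2
  exact (congrArg (fun T : EuclideanSpace ℝ (Fin d) →L[ℝ] EuclideanSpace ℝ (Fin k) ↦ T w) h2).symm

end ClosestPoint

/-! ### Regularity of p near Γ, with uniform constants -/

section Regularity

variable {d k : ℕ} {M : Type*} [TopologicalSpace M] [ChartedSpace (EuclideanSpace ℝ (Fin d)) M]
  {ι : M → EuclideanSpace ℝ (Fin k)}

/-- `x` has a unique closest point on `range ι`, near `x` the closest point projection is `C²`, and
its differential at `x` vanishes on the normal space at the closest point. -/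
structure IsRegularPoint (ι : M → EuclideanSpace ℝ (Fin k)) (x : EuclideanSpace ℝ (Fin k)) :
    Prop where
  existsUnique : ∃! q, IsClosestPoint (range ι) x q
  contDiffAt : ContDiffAt ℝ 2 (closestPointProjection (range ι)) x
  fderiv_normal : ∀ m : M, ι m = closestPointProjection (range ι) x →
    ∀ n ∈ (tangentPlane (d := d) ι m)ᗮ, fderiv ℝ (closestPointProjection (range ι)) x n = 0

/-- Reduces global minimization to the local equation. Since `ι` is a topological embedding, closest
points near `ι m₀` have parameters near `m₀`; no other sheet of Γ interferes. -/
theorem eventually_closestPoint_eq [IsManifold (𝓡 d) ∞ M]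
    (hι : Manifold.IsSmoothEmbedding (𝓡 d) 𝓘(ℝ, EuclideanSpace ℝ (Fin k)) ∞ ι) (m₀ : M) :
    ∃ (φ : OpenPartialHomeomorph M (EuclideanSpace ℝ (Fin d)))
      (g : EuclideanSpace ℝ (Fin k) → EuclideanSpace ℝ (Fin d)),
      φ ∈ IsManifold.maximalAtlas (𝓡 d) ∞ M ∧ m₀ ∈ φ.source ∧
      ContDiffAt ℝ ∞ g (ι m₀) ∧ g (ι m₀) = φ m₀ ∧
      (∀ᶠ v in 𝓝 (ι m₀, φ m₀), footDefect (ι ∘ φ.symm) v = 0 ↔ g v.1 = v.2) ∧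
      ∀ᶠ x in 𝓝 (ι m₀), ∀ m, IsClosestPoint (range ι) x (ι m) → m ∈ φ.source ∧ φ m = g x := by
  have him := hι.isImmersion.isImmersionAt m₀
  have hsm := hι.contMDiff
  set φ := him.domChart with hφ
  have hφM : φ ∈ IsManifold.maximalAtlas (𝓡 d) ∞ M := him.domChart_mem_maximalAtlas
  have hm₀ : m₀ ∈ φ.source := him.mem_domChart_source
  obtain ⟨g, hg, hg0, hiff⟩ := exists_foot
    (contDiffAt_comp_symm_of_mem_maximalAtlas hφM hsm (φ.map_source hm₀))
    (him.injective_fderiv_comp_symm hsm)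
  have hf0 : (ι ∘ φ.symm) (φ m₀) = ι m₀ := by simp [φ.left_inv hm₀]
  rw [hf0] at hg hg0 hiff
  refine ⟨φ, g, hφM, hm₀, hg, hg0, hiff, ?_⟩
  rw [nhds_prod_eq] at hiff
  obtain ⟨A, hA, B, hB, hAB⟩ := eventually_prod_iff.1 hiff
  have hBm : ∀ᶠ m in 𝓝 m₀, m ∈ φ.source ∧ B (φ m) :=
    (φ.open_source.eventually_mem hm₀).and ((φ.continuousAt hm₀).eventually hB)
  rw [hι.isEmbedding.nhds_eq_comap, eventually_comap] at hBm
  obtain ⟨ε, hε, hball⟩ := Metric.eventually_nhds_iff.1 hBm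
  filter_upwards [hA, Metric.ball_mem_nhds (ι m₀) (half_pos hε)] with x hxA hx m hm
  have hmB : m ∈ φ.source ∧ B (φ m) := by
    refine hball ?_ m rfl
    have := hm.dist_le_two_mul (mem_range_self m₀)
    rw [Metric.mem_ball] at hx
    linarith
  refine ⟨hmB.1, ((hAB hxA hmB.2).1 ?_).symm⟩
  have hu := φ.map_source hmB.1
  refine footDefect_eq_zero_of_isLocalMin
    ((contDiffAt_comp_symm_of_mem_maximalAtlas hφM hsm hu).differentiableAt (by simp))
    (Eventually.of_forall fun v ↦ ?_)
  simp only [Function.comp_apply, φ.left_inv hmB.1]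
  exact hm.dist_le (mem_range_self _)

theorem eventually_isRegularPoint [CompactSpace M] [Nonempty M]
    [IsManifold (𝓡 d) ∞ M]
    (hι : Manifold.IsSmoothEmbedding (𝓡 d) 𝓘(ℝ, EuclideanSpace ℝ (Fin k)) ∞ ι) (m₀ : M) :
    ∀ᶠ x in 𝓝 (ι m₀), IsRegularPoint (d := d) ι x := by
  obtain ⟨φ, g, hφM, hm₀, hg, hg0, hiff, hcl⟩ := eventually_closestPoint_eq hι m₀
  have hsm := hι.contMDiff
  have hΓ : IsCompact (range ι) := isCompact_range hsm.continuous
  have hclosest := isClosestPoint_closestPointProjection hΓ (range_nonempty ι)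
  have hpg : ∀ᶠ x in 𝓝 (ι m₀), closestPointProjection (range ι) x = ι (φ.symm (g x)) := by
    filter_upwards [hcl] with x hx
    obtain ⟨m, hm⟩ := (hclosest x).1
    have h := hx m (hm ▸ hclosest x)
    rw [← hm, ← h.2, φ.left_inv h.1]
  have hfs : ContDiffAt ℝ ∞ (ι ∘ φ.symm) (g (ι m₀)) := by
    rw [hg0]
    exact contDiffAt_comp_symm_of_mem_maximalAtlas hφM hsm (φ.map_source hm₀)
  have hp : ∀ᶠ x in 𝓝 (ι m₀), ContDiffAt ℝ 2 (closestPointProjection (range ι)) x :=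
    (((hfs.comp _ hg).congr_of_eventuallyEq hpg).of_le (by norm_cast)).eventually (by simp)
  have hiff' : ∀ᶠ x in 𝓝 (ι m₀), ∀ᶠ v in 𝓝 (x, g x),
      footDefect (ι ∘ φ.symm) v = 0 ↔ g v.1 = v.2 := by
    have : ContinuousAt (fun x ↦ (x, g x)) (ι m₀) := continuousAt_id.prodMk hg.continuousAt
    have h := eventually_eventually_nhds.2 hiff
    rw [← hg0] at h
    exact this.eventually h
  filter_upwards [hcl, hp, hpg.eventually_nhds, hiff'] with x hx hpx hpgx hiffx
  refine ⟨⟨_, hclosest x, fun q hq ↦ ?_⟩, hpx, fun m hm n hn ↦ ?_⟩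
  · obtain ⟨m, rfl⟩ := hq.1
    have h := hx m hq
    rw [hpgx.self_of_nhds, ← h.2, φ.left_inv h.1]
  · have h := hx m (hm ▸ hclosest x)
    have hline : ContinuousAt (fun s : ℝ ↦ x + s • n) 0 := by fun_prop
    have hx0 : x + (0 : ℝ) • n = x := by simp
    have hpair : ContinuousAt (fun s : ℝ ↦ (x + s • n, g x)) 0 := hline.prodMk continuousAt_const
    have hfoot : footDefect (ι ∘ φ.symm) (x, g x) = 0 := hiffx.self_of_nhds.2 rfl
    -- Adding `s • n` changes the defect by a multiple of ⟨n, Df w⟩ = 0, so the parameter `g x`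
    -- still solves the equation.
    have hconst : ∀ᶠ s : ℝ in 𝓝 0, closestPointProjection (range ι) (x + s • n) =
        closestPointProjection (range ι) x := by
      filter_upwards [hline.eventually (by simpa [hx0] using hpgx),
        hpair.eventually (by simpa [hx0] using hiffx)] with s hs1 hs2
      have : g (x + s • n) = g x := by
        refine hs2.1 ?_
        ext w
        have h1 : inner ℝ ((ι ∘ φ.symm) (g x) - x) (fderiv ℝ (ι ∘ φ.symm) (g x) w) = 0 := by
          rw [← footDefect_apply, hfoot]; rfl
        have h2 : inner ℝ n (fderiv ℝ (ι ∘ φ.symm) (g x) w) = 0 := by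
          rw [← h.2]
          exact Submodule.inner_left_of_mem_orthogonal
            (range_fderiv_comp_symm_le_tangentPlane hφM hsm h.1 w) hn
        rw [footDefect_apply, ← sub_sub, inner_sub_left, h1, real_inner_smul_left, h2]
        simp
      rw [hs1, this, hpgx.self_of_nhds]
    have hd : HasDerivAt (fun s : ℝ ↦ x + s • n) n 0 := by
      simpa using ((hasDerivAt_id (0 : ℝ)).smul_const n).const_add x
    have hpd : HasFDerivAt (closestPointProjection (range ι))
        (fderiv ℝ (closestPointProjection (range ι)) x) (x + (0 : ℝ) • n) := by
      rw [hx0]; exact (hpx.differentiableAt (by simp)).hasFDerivAt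
    have hcomp := hpd.comp_hasDerivAt 0 hd
    exact hcomp.unique
      ((hasDerivAt_const 0 (closestPointProjection (range ι) x)).congr_of_eventuallyEq hconst)

/-- The quantitative properties of the closest point projection hold uniformly near the compact
manifold. -/
theorem exists_uniform_tubularNhd [CompactSpace M] [Nonempty M]
    [IsManifold (𝓡 d) ∞ M]
    (hι : Manifold.IsSmoothEmbedding (𝓡 d) 𝓘(ℝ, EuclideanSpace ℝ (Fin k)) ∞ ι) :
    ∃ δ₀ : ℝ, 0 < δ₀ ∧ ∃ C : ℝ, 0 ≤ C ∧ ∀ x ∈ tubularNhd (range ι) δ₀,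
      IsRegularPoint (d := d) ι x ∧
      ‖fderiv ℝ (closestPointProjection (range ι)) (closestPointProjection (range ι) x) -
        fderiv ℝ (closestPointProjection (range ι)) x‖ ≤ C * Metric.infDist x (range ι) := by
  have hΓ : IsCompact (range ι) := isCompact_range hι.contMDiff.continuous
  have hclosest := isClosestPoint_closestPointProjection hΓ (range_nonempty ι)
  set p := closestPointProjection (range ι)
  have key : ∃ δ₀ : ℝ, 0 < δ₀ ∧ ∃ C : ℝ, 0 ≤ C ∧ ∀ x, (∃ q ∈ range ι, dist x q < δ₀) →
      IsRegularPoint (d := d) ι x ∧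
      ‖fderiv ℝ p (p x) - fderiv ℝ p x‖ ≤ C * Metric.infDist x (range ι) := by
    refine hΓ.induction_on (p := fun S ↦ ∃ δ₀ : ℝ, 0 < δ₀ ∧ ∃ C : ℝ, 0 ≤ C ∧
      ∀ x, (∃ q ∈ S, dist x q < δ₀) → IsRegularPoint (d := d) ι x ∧
      ‖fderiv ℝ p (p x) - fderiv ℝ p x‖ ≤ C * Metric.infDist x (range ι)) ?_ ?_ ?_ ?_
    · exact ⟨1, one_pos, 0, le_rfl, by simp⟩
    · rintro S T hST ⟨δ, hδ, C, hC, h⟩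
      exact ⟨δ, hδ, C, hC, fun x ⟨q, hq, hx⟩ ↦ h x ⟨q, hST hq, hx⟩⟩
    · rintro S T ⟨δ, hδ, C, hC, h⟩ ⟨δ', hδ', C', hC', h'⟩
      refine ⟨min δ δ', lt_min hδ hδ', max C C', hC.trans (le_max_left _ _), ?_⟩
      rintro x ⟨q, hq | hq, hx⟩
      · obtain ⟨h1, h2⟩ := h x ⟨q, hq, hx.trans_le (min_le_left _ _)⟩
        exact ⟨h1, h2.trans (mul_le_mul_of_nonneg_right (le_max_left _ _) Metric.infDist_nonneg)⟩
      · obtain ⟨h1, h2⟩ := h' x ⟨q, hq, hx.trans_le (min_le_right _ _)⟩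
        exact ⟨h1, h2.trans (mul_le_mul_of_nonneg_right (le_max_right _ _) Metric.infDist_nonneg)⟩
    · rintro _ ⟨m₀, rfl⟩
      have hreg := eventually_isRegularPoint hι m₀
      -- As p is C², Dp is C¹ and hence locally Lipschitz.
      obtain ⟨K, t, ht, hK⟩ := (hreg.self_of_nhds.contDiffAt.fderiv_right
        (m := 1) (by norm_num)).exists_lipschitzOnWith
      obtain ⟨ε, hε, hball⟩ := Metric.eventually_nhds_iff.1 (hreg.and ht)
      -- Two quarters put `x` within ε/2 of `ι m₀`; projecting at most doubles this, so `p x` stays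
      -- within ε.
      refine ⟨Metric.ball (ι m₀) (ε / 4),
        mem_nhdsWithin_of_mem_nhds (Metric.ball_mem_nhds _ (by positivity)),
        ε / 4, by positivity, K, K.2, ?_⟩
      rintro x ⟨q, hq, hxq⟩
      rw [Metric.mem_ball] at hq
      have hx : dist x (ι m₀) < ε / 2 := by
        have := dist_triangle x q (ι m₀)
        linarith
      have hpx : dist (p x) (ι m₀) < ε := by
        have := (hclosest x).dist_le_two_mul (mem_range_self m₀)
        linarith
      obtain ⟨h1, h2⟩ := hball (hx.trans (by linarith))
      refine ⟨h1, ?_⟩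
      rw [← (hclosest x).2, dist_comm x, ← dist_eq_norm]
      exact hK.dist_le_mul _ (hball hpx).2 _ h2
  obtain ⟨δ₀, hδ₀, C, hC, h⟩ := key
  exact ⟨δ₀, hδ₀, C, hC, fun x hx ↦ h x ((Metric.infDist_lt_iff (range_nonempty ι)).1 hx)⟩

theorem fderiv_closestPointProjection_eq_tangentProjection [CompactSpace M]
    [IsManifold (𝓡 d) ∞ M]
    (hι : ContMDiff (𝓡 d) 𝓘(ℝ, EuclideanSpace ℝ (Fin k)) ∞ ι) {m : M}
    (hm : IsRegularPoint (d := d) ι (ι m)) :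
    fderiv ℝ (closestPointProjection (range ι)) (ι m) = tangentProjection (d := d) ι m := by
  ext1 v
  have h1 := fderiv_closestPointProjection_of_mem_tangentPlane hι
    (hm.contDiffAt.differentiableAt (by simp))
    ((tangentPlane (d := d) ι m).starProjection_apply_mem v)
  have h2 := hm.fderiv_normal m
    (closestPointProjection_of_mem (isCompact_range hι.continuous) (mem_range_self m)).symm _
    ((tangentPlane (d := d) ι m).sub_starProjection_mem_orthogonal v)
  rw [map_sub, sub_eq_zero, h1] at h2
  exact h2

theorem IsRegularPoint.fderiv_comp_tangentProjection {x : EuclideanSpace ℝ (Fin k)}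
    (hx : IsRegularPoint (d := d) ι x) {m : M} (hm : ι m = closestPointProjection (range ι) x) :
    fderiv ℝ (closestPointProjection (range ι)) x ∘L tangentProjection (d := d) ι m =
      fderiv ℝ (closestPointProjection (range ι)) x := by
  ext1 v
  have h := hx.fderiv_normal m hm _
    ((tangentPlane (d := d) ι m).sub_starProjection_mem_orthogonal v)
  rw [map_sub, sub_eq_zero] at h
  exact h.symm

theorem tangentProjection_comp_self (ι : M → EuclideanSpace ℝ (Fin k)) (m : M) :
    tangentProjection (d := d) ι m ∘L tangentProjection (d := d) ι m =
      tangentProjection (d := d) ι m :=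
  (tangentPlane (d := d) ι m).isIdempotentElem_starProjection

theorem continuousOn_closestPointProjection {S : Set (EuclideanSpace ℝ (Fin k))}
    (hS : ∀ x ∈ S, IsRegularPoint (d := d) ι x) :
    ContinuousOn (closestPointProjection (range ι)) S :=
  fun x hx ↦ (hS x hx).contDiffAt.continuousAt.continuousWithinAt

end Regularity

theorem isOpen_tubularNhd {k : ℕ} (Γ : Set (EuclideanSpace ℝ (Fin k))) (δ : ℝ) :
    IsOpen (tubularNhd Γ δ) :=
  isOpen_lt (Metric.continuous_infDist_pt Γ) continuous_const

theorem tubularNhd_mono {k : ℕ} (Γ : Set (EuclideanSpace ℝ (Fin k))) {δ δ' : ℝ} (h : δ ≤ δ') :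
    tubularNhd Γ δ ⊆ tubularNhd Γ δ' :=
  fun _ hx ↦ lt_of_lt_of_le hx h

theorem mem_tubularNhd_of_mem {k : ℕ} {Γ : Set (EuclideanSpace ℝ (Fin k))} {δ : ℝ} (hδ : 0 < δ)
    {q : EuclideanSpace ℝ (Fin k)} (hq : q ∈ Γ) : q ∈ tubularNhd Γ δ :=
  (Metric.infDist_zero_of_mem hq).trans_lt hδ

theorem mainTheorem9 {d k : ℕ} {M : Type*} [TopologicalSpace M] [CompactSpace M] [Nonempty M]
    [ChartedSpace (EuclideanSpace ℝ (Fin d)) M] [IsManifold (𝓡 d) ∞ M]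
    (ι : M → EuclideanSpace ℝ (Fin k))
    (hι : Manifold.IsSmoothEmbedding (𝓡 d) 𝓘(ℝ, EuclideanSpace ℝ (Fin k)) ∞ ι) :
    ∃ δ₀ : ℝ, 0 < δ₀ ∧ ∃ C : ℝ, ∀ δ : ℝ, 0 < δ → δ ≤ δ₀ →
      (∀ x ∈ tubularNhd (Set.range ι) δ, ∃! q, IsClosestPoint (Set.range ι) x q) ∧
      ∃ H : EuclideanSpace ℝ (Fin k) →
          (EuclideanSpace ℝ (Fin k) →L[ℝ] EuclideanSpace ℝ (Fin k)),
        Measurable H ∧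
        ∀ x ∈ tubularNhd (Set.range ι) δ,
          ‖H x‖ ≤ C ∧
          ∀ m : M, ι m = closestPointProjection (Set.range ι) x →
            HasFDerivAt (closestPointProjection (Set.range ι))
              (tangentProjection (d := d) ι m ∘L
                (ContinuousLinearMap.id ℝ (EuclideanSpace ℝ (Fin k)) -
                  Metric.infDist x (Set.range ι) • H x)) x ∧
            H x ∘L tangentProjection (d := d) ι m = H x := by
  classical
  obtain ⟨δ₀, hδ₀, C, hC, hreg⟩ := exists_uniform_tubularNhd hι
  have hΓ : IsCompact (range ι) := isCompact_range hι.contMDiff.continuous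
  have hclosest := isClosestPoint_closestPointProjection hΓ (range_nonempty ι)
  set p := closestPointProjection (range ι) with hp
  set U := tubularNhd (range ι) δ₀ with hU
  -- Outside `U` the choice of p is arbitrary and need not be measurable, so it is replaced by 0.
  have hmeas : Measurable (U.piecewise p 0) :=
    (continuousOn_closestPointProjection fun x hx ↦ (hreg x hx).1).measurable_piecewise
      continuous_const.continuousOn (isOpen_tubularNhd _ _).measurableSet
  refine ⟨δ₀, hδ₀, C, fun δ _ hδ ↦
    ⟨fun x hx ↦ (hreg x (tubularNhd_mono _ hδ hx)).1.existsUnique,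
      -- On Γ the inverse of 0 is 0, so H vanishes there.
      fun x ↦ (Metric.infDist x (range ι))⁻¹ •
        (fderiv ℝ p (U.piecewise p 0 x) - fderiv ℝ p x), ?_, fun x hx ↦ ?_⟩⟩
  · have : SecondCountableTopology
        (EuclideanSpace ℝ (Fin k) →L[ℝ] EuclideanSpace ℝ (Fin k)) :=
      have := FiniteDimensional.proper ℝ (EuclideanSpace ℝ (Fin k) →L[ℝ] EuclideanSpace ℝ (Fin k))
      inferInstance
    exact (Metric.continuous_infDist_pt _).measurable.inv.smul
      (((measurable_fderiv ℝ p).comp hmeas).sub (measurable_fderiv ℝ p))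
  have hxU : x ∈ U := tubularNhd_mono _ hδ hx
  obtain ⟨hx1, hx2⟩ := hreg x hxU
  simp only [Set.piecewise_eq_of_mem _ _ _ hxU]
  refine ⟨?_, fun m hm ↦ ?_⟩
  · rw [norm_smul, norm_inv, Real.norm_of_nonneg Metric.infDist_nonneg]
    exact inv_mul_le_of_le_mul₀ Metric.infDist_nonneg hC (by rwa [mul_comm])
  have hpx := (hreg _ (mem_tubularNhd_of_mem hδ₀ (mem_range_self m))).1
  have hP := fderiv_closestPointProjection_eq_tangentProjection hι.contMDiff hpx
  have hdx := hx1.contDiffAt.differentiableAt (by simp)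
  have hcomp := fderiv_closestPointProjection_comp_self hΓ (range_nonempty ι) hdx
    (by rw [← hp, ← hm]; exact hpx.contDiffAt.differentiableAt (by simp))
  have hcomp' := hx1.fderiv_comp_tangentProjection hm
  rw [← hp] at hP hcomp hcomp' hdx
  rw [← hm, hP] at hcomp ⊢
  have hPP := tangentProjection_comp_self (d := d) ι m
  constructor
  · have hsmul : Metric.infDist x (range ι) • (Metric.infDist x (range ι))⁻¹ •
        (tangentProjection (d := d) ι m - fderiv ℝ p x) =
        tangentProjection (d := d) ι m - fderiv ℝ p x := by
      -- On Γ cancelling the distance is not possible, but there Dp(x) = P and both sides are zero.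
      by_cases h0 : Metric.infDist x (range ι) = 0
      · have hxm : x = ι m := by
          rw [hm, ← dist_eq_zero, (hclosest x).2, h0]
        rw [hxm, hP]
        simp
      · rw [smul_smul, mul_inv_cancel₀ h0, one_smul]
    rw [hsmul, ContinuousLinearMap.comp_sub, ContinuousLinearMap.comp_id,
      ContinuousLinearMap.comp_sub, hPP, hcomp, sub_sub_cancel]
    exact hdx.hasFDerivAt
  · rw [ContinuousLinearMap.smul_comp, ContinuousLinearMap.sub_comp, hPP, hcomp']
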